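/- Let $q$ be an odd prime power and $\mathbb F_q$ the field with $q$ elements. For $n\ge 0$ put $\mathrm{dot}_n(x)=x_1^2+\cdots+x_n^2$ on $\mathbb F_q^n$. For $0\le k\le n$ let the dot-binomial coefficient $\binom{n}{k}_d$ be the number of $k$-dimensional subspaces $W\subseteq\mathbb F_q^n$ such that $(W,\mathrm{dot}_n|_W)$ is isometrically isomorphic to $(\mathbb F_q^k,\mathrm{dot}_k)$. Let $$\binom{a}{b}_{q^2}=\frac{(q^{2a}-1)(q^{2(a-1)}-1)\cdots(q^{2(a-b+1)}-1)}{(q^{2b}-1)(q^{2(b-1)}-1)\cdots(q^2-1)}$$ be the $q^2$-binomial coefficient (equal to $1$ when $b=0$). For signs $s,t,u\in\{+1,-1\}$ abbreviate $$A_s=\tfrac12 q^{\frac{k(n-k)}2}\bigl(q^{\frac{n-k}2}+s\bigr)\binom{(n-1)/2}{(k-1)/2}_{q^2},\qquad B_s=\tfrac12 q^{\frac{k(n-k)}2}\bigl(q^{\frac k2}+s\bigr)\binom{(n-1)/2}{k/2}_{q^2},$$ $$C_s=\tfrac12 q^{\frac{k(n-k)-1}2}\bigl(q^{\frac n2}+s\bigr)\binom{(n-2)/2}{(k-1)/2}_{q^2},\qquad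 D_{s,t,u}=\tfrac12 q^{\frac{k(n-k)}2}\,\frac{\bigl(q^{\frac{n-k}2}+s\bigr)\bigl(q^{\frac k2}+t\bigr)}{q^{\frac n2}+u}\binom{n/2}{k/2}_{q^2}.$$ Then for all $0\le k\le n$ the following holds. **Theorem.** (1) If $q\equiv1\pmod 4$, then $\binom nk_d$ equals $A_{+}$ if $n,k$ are odd; $B_{+}$ if $n$ is odd and $k$ is even; $C_{-}$ if $n$ is even and $k$ is odd; $D_{+,+,+}$ if $n,k$ are even. (2) If $q\equiv3\pmod 4$, then $\binom nk_d$ is given by the following table. $$\begin{array}{c|cccc} & k\equiv1\ (4) & k\equiv2\ (4) & k\equiv3\ (4) & k\equiv0\ (4)\\\hline n\equiv1\ (4) & A_{+} & B_{-} & A_{-} & B_{+}\\ n\equiv2\ (4) & C_{+} & D_{+,-,-} & C_{+} & D_{-,+,-}\\ n\equiv3\ (4) & A_{-} & B_{-} & A_{+} & B_{+}\\ n\equiv0\ (4) & C_{-} & D_{-,-,+} & C_{-} & D_{+,+,+} \end{array}$$ -/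

import Mathlib

/-- The quadratic form `dot_n(x) = x₁² + ⋯ + x_n²` on `F ^ n`. -/
noncomputable def dotForm (F : Type*) [Field F] (n : ℕ) : QuadraticForm F (Fin n → F) :=
  QuadraticMap.weightedSumSquares F (fun _ : Fin n => (1 : F))

theorem dotForm_apply (F : Type*) [Field F] (n : ℕ) (x : Fin n → F) :
    dotForm F n x = ∑ i, x i ^ 2 := by
  simp [dotForm, QuadraticMap.weightedSumSquares_apply, pow_two]

/-- A `dot_k`-subspace of `(F ^ n, dot_n)`: a `k`-dimensional subspace `W` such that the restriction
of `dot_n` to `W` is isometrically isomorphic to `(F ^ k, dot_k)`. -/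
def IsDotSubspace (F : Type*) [Field F] (n k : ℕ) (W : Submodule F (Fin n → F)) : Prop :=
  Module.finrank F W = k ∧
    QuadraticMap.Equivalent (QuadraticMap.restrict (dotForm F n) W) (dotForm F k)

/-- The dot-binomial coefficient: the number of `dot_k`-subspaces of `(F ^ n, dot_n)`. -/
noncomputable def dotBinom (F : Type*) [Field F] (n k : ℕ) : ℕ :=
  Nat.card {W : Submodule F (Fin n → F) // IsDotSubspace F n k W}

/-- The Gaussian binomial coefficient with base `Q`, for `k ≤ n` and `1 < Q`:
`((Q^n - 1)(Q^(n-1) - 1) ⋯ (Q^(n-k+1) - 1)) / ((Q^k - 1)(Q^(k-1) - 1) ⋯ (Q - 1))`. -/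
def gaussBinom (Q : ℚ) (n k : ℕ) : ℚ :=
  (∏ i ∈ Finset.range k, (Q ^ (n - i) - 1)) / (∏ i ∈ Finset.range k, (Q ^ (k - i) - 1))

open Matrix

/-! A `dot_k`-subspace is the span of an orthonormal `k`-frame, and each one has as many such frames
as `F ^ k`, so `dotBinom` is a quotient of frame counts (`dotBinom_mul_frameCount`). Isometries act
transitively on unit vectors, so a frame is a unit vector followed by a frame one dimension lower
(`frameCount_succ_succ`). With S(m) the number of unit vectors of `F ^ m`, this yields the recursion
binom(n+1, k+1) S(k+1) = S(n+1) binom(n, k) (`dotBinom_succ_succ`).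

A Jacobi sum evaluates S, with all signs powers of ε = χ(-1), χ the quadratic character. As ε² = 1,
consecutive sphere counts contribute (q^m - ε^m)(q^m + ε^m) = (q²)^m - 1, the source of the
q²-binomials. Since ε = ±1 according to q mod 4, the table is a matter of parities of exponents. -/

/-- A family of `k` orthonormal vectors of `F ^ n`, with respect to the dot product. -/
def IsOrthonormalFrame {F : Type*} [Field F] {k n : ℕ} (v : Fin k → Fin n → F) : Prop :=
  ∀ i j, v i ⬝ᵥ v j = if i = j then 1 else 0

/-- The number of orthonormal `k`-frames in `F ^ n`. -/
noncomputable def frameCount (F : Type*) [Field F] (n k : ℕ) : ℕ :=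
  Nat.card {v : Fin k → Fin n → F // IsOrthonormalFrame v}

/-- The number of vectors of `F ^ n` on which `dot_n` takes the value `a`. -/
noncomputable def sphereCount (F : Type*) [Field F] (n : ℕ) (a : F) : ℕ :=
  Nat.card {x : Fin n → F // x ⬝ᵥ x = a}

/-! ### Transitivity of isometries on unit vectors -/

section Reflections

variable {F : Type*} [Field F]

theorem exists_isometry_of_dotProduct_self_ne_zero {n : ℕ} (s : F) (hs : s * s = 1)
    (w : Fin n → F) (hw : w ⬝ᵥ w ≠ 0) :
    ∃ T : (Fin n → F) ≃ (Fin n → F), (∀ x y, T x ⬝ᵥ T y = x ⬝ᵥ y) ∧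
      ∀ x, T x = s • (x - (2 * (x ⬝ᵥ w) / (w ⬝ᵥ w)) • w) := by
  have hinv : Function.Involutive
      (fun x : Fin n → F => s • (x - (2 * (x ⬝ᵥ w) / (w ⬝ᵥ w)) • w)) := by
    intro x
    have h : (s • (x - (2 * (x ⬝ᵥ w) / (w ⬝ᵥ w)) • w)) ⬝ᵥ w = - s * (x ⬝ᵥ w) := by
      simp only [smul_dotProduct, sub_dotProduct, smul_eq_mul]
      field_simp
      ring
    simp only [h]
    ext i
    simp only [Pi.smul_apply, Pi.sub_apply, smul_eq_mul]
    linear_combination (x i) * hs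
  refine ⟨hinv.toPerm _, fun x y => ?_, fun x => rfl⟩
  simp only [Function.Involutive.coe_toPerm, smul_dotProduct, dotProduct_smul, sub_dotProduct,
    dotProduct_sub, smul_eq_mul, dotProduct_comm w y]
  field_simp
  linear_combination (w ⬝ᵥ w) * (x ⬝ᵥ y) * hs

/-- If u - v is anisotropic, the reflection along it swaps u and v. Otherwise u ⬝ᵥ v = 1, so u + v
has norm 4 ≠ 0, and the negated reflection along u + v sends u to v. -/
theorem exists_isometry_apply_eq (h2 : (2 : F) ≠ 0) {n : ℕ} (u v : Fin n → F)
    (hu : u ⬝ᵥ u = 1) (hv : v ⬝ᵥ v = 1) :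
    ∃ T : (Fin n → F) ≃ (Fin n → F), (∀ x y, T x ⬝ᵥ T y = x ⬝ᵥ y) ∧ T u = v := by
  by_cases h : (u - v) ⬝ᵥ (u - v) = 0
  · have huv : u ⬝ᵥ v = 1 := by
      simp only [sub_dotProduct, dotProduct_sub, dotProduct_comm v u, hu, hv] at h
      apply mul_left_cancel₀ h2
      linear_combination -h
    have h4 : (u + v) ⬝ᵥ (u + v) = 4 := by
      simp only [add_dotProduct, dotProduct_add, dotProduct_comm v u, hu, hv, huv]; norm_num
    have h40 : (4 : F) ≠ 0 := by
      rw [show (4 : F) = 2 * 2 by norm_num]; exact mul_ne_zero h2 h2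
    obtain ⟨T, hT, hTx⟩ := exists_isometry_of_dotProduct_self_ne_zero (-1 : F) (by ring) (u + v)
      (by rwa [h4])
    refine ⟨T, hT, ?_⟩
    rw [hTx, h4, dotProduct_add, hu, huv, show (2 * (1 + 1) / 4 : F) = 1 by
      rw [div_eq_one_iff_eq h40]; norm_num]
    simp
  · obtain ⟨T, hT, hTx⟩ := exists_isometry_of_dotProduct_self_ne_zero (1 : F) (by ring) (u - v) h
    refine ⟨T, hT, ?_⟩
    have h3 : (u - v) ⬝ᵥ (u - v) = 2 * (u ⬝ᵥ (u - v)) := by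
      simp only [sub_dotProduct, dotProduct_sub, dotProduct_comm v u, hu, hv]; ring
    rw [hTx, ← h3, div_self h]
    simp

end Reflections

/-! ### Counting orthonormal frames and the diagonal recursion -/

section Frames

variable {F : Type*} [Field F]

theorem IsOrthonormalFrame.linearIndependent {k n : ℕ} {v : Fin k → Fin n → F}
    (hv : IsOrthonormalFrame v) : LinearIndependent F v := by
  rw [Fintype.linearIndependent_iff]
  intro c hc j
  have h := congrArg (fun x => x ⬝ᵥ v j) hc
  simpa [sum_dotProduct, hv _ j] using h

/-- Isometries transport the frames starting with `u` to the frames starting with `T u`. -/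
def frameFiberCongr {k n : ℕ} (T : (Fin n → F) ≃ (Fin n → F))
    (hT : ∀ x y, T x ⬝ᵥ T y = x ⬝ᵥ y) (u : Fin n → F) :
    {v : Fin (k + 1) → Fin n → F // IsOrthonormalFrame v ∧ v 0 = u} ≃
      {v : Fin (k + 1) → Fin n → F // IsOrthonormalFrame v ∧ v 0 = T u} :=
  (Equiv.arrowCongr (Equiv.refl _) T).subtypeEquiv fun v => by
    simp [IsOrthonormalFrame, hT]

/-- Frames of `F ^ (n + 1)` starting with the first standard vector are frames of `F ^ n`. -/
def frameFiberStdEquiv (k n : ℕ) :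
    {v : Fin (k + 1) → Fin (n + 1) → F // IsOrthonormalFrame v ∧ v 0 = Fin.cons 1 0} ≃
      {v : Fin k → Fin n → F // IsOrthonormalFrame v} where
  toFun v := ⟨fun i => Fin.tail (v.1 i.succ), by
    obtain ⟨v, hv, h0⟩ := v
    -- Orthogonality to the first standard vector kills the first coordinate.
    have hz : ∀ i : Fin k, v i.succ 0 = 0 := fun i => by
      have := hv 0 i.succ
      simpa [h0, dotProduct, Fin.sum_univ_succ, Fin.succ_ne_zero, (Fin.succ_ne_zero _).symm]
        using this
    intro i j
    have := hv i.succ j.succ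
    simpa [dotProduct, Fin.sum_univ_succ, hz, Fin.tail] using this⟩
  invFun w := ⟨Fin.cons (Fin.cons 1 0) fun i => Fin.cons 0 (w.1 i), by
    refine ⟨fun i j => ?_, rfl⟩
    refine Fin.cases ?_ (fun i => ?_) i <;> refine Fin.cases ?_ (fun j => ?_) j
    · simp [dotProduct, Fin.sum_univ_succ]
    · simp [dotProduct, Fin.sum_univ_succ, (Fin.succ_ne_zero _).symm]
    · simp [dotProduct, Fin.sum_univ_succ]
    · simpa [dotProduct, Fin.sum_univ_succ] using w.2 i j⟩
  left_inv v := by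
    obtain ⟨v, hv, h0⟩ := v
    have hz : ∀ i : Fin k, v i.succ 0 = 0 := fun i => by
      have := hv 0 i.succ
      simpa [h0, dotProduct, Fin.sum_univ_succ, Fin.succ_ne_zero, (Fin.succ_ne_zero _).symm]
        using this
    ext i j
    refine Fin.cases ?_ (fun i => ?_) i
    · simp [h0]
    · refine Fin.cases ?_ (fun j => ?_) j
      · simp [hz]
      · simp [Fin.tail]
  right_inv w := by
    ext i j
    simp [Fin.tail]

/-- Fibre the frames over their first vector: an isometry carries each fibre to the one over the
first standard vector. -/
theorem frameCount_succ_succ (h2 : (2 : F) ≠ 0) (n k : ℕ) :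
    frameCount F (n + 1) (k + 1) = sphereCount F (n + 1) 1 * frameCount F n k := by
  rw [frameCount, frameCount, sphereCount, ← Nat.card_prod]
  apply Nat.card_congr
  let f : {v : Fin (k + 1) → Fin (n + 1) → F // IsOrthonormalFrame v} →
      {x : Fin (n + 1) → F // x ⬝ᵥ x = 1} := fun v => ⟨v.1 0, by simpa using v.2 0 0⟩
  refine (Equiv.sigmaFiberEquiv f).symm.trans
    ((Equiv.sigmaCongrRight fun u => ?_).trans (Equiv.sigmaEquivProd _ _))
  have hex := exists_isometry_apply_eq h2 u.1 (Fin.cons 1 0) u.2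
    (by simp [dotProduct, Fin.sum_univ_succ])
  let e := frameFiberCongr (k := k) hex.choose hex.choose_spec.1 u.1
  rw [hex.choose_spec.2] at e
  exact ((Equiv.subtypeEquivRight fun v => by simp [f, Subtype.ext_iff]).trans
    (Equiv.subtypeSubtypeEquivSubtypeInter _ fun v => v 0 = u.1)).trans
    (e.trans (frameFiberStdEquiv k n))

theorem frameCount_zero_right (n : ℕ) : frameCount F n 0 = 1 := by
  rw [frameCount, Nat.card_eq_one_iff_unique]
  exact ⟨inferInstance, ⟨⟨fun i => i.elim0, fun i => i.elim0⟩⟩⟩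

theorem frameCount_self_pos [Finite F] (k : ℕ) : 0 < frameCount F k k := by
  rw [frameCount, Nat.card_pos_iff]
  exact ⟨⟨⟨fun i => Pi.single i 1, fun i j => by simp [Pi.single_apply, eq_comm]⟩⟩, inferInstance⟩

theorem dotForm_eq_dotProduct (n : ℕ) (x : Fin n → F) : dotForm F n x = x ⬝ᵥ x := by
  rw [dotForm_apply, dotProduct]
  simp [pow_two]

/-- Polarization, which needs 2 to be invertible. -/
theorem dotProduct_eq_of_isometry (h2 : (2 : F) ≠ 0) {n k : ℕ} {W : Submodule F (Fin n → F)}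
    (φ : (QuadraticMap.restrict (dotForm F n) W).IsometryEquiv (dotForm F k)) (x y : W) :
    φ x ⬝ᵥ φ y = (x : Fin n → F) ⬝ᵥ (y : Fin n → F) := by
  have h : ∀ z : W, φ z ⬝ᵥ φ z = (z : Fin n → F) ⬝ᵥ (z : Fin n → F) := fun z => by
    rw [← dotForm_eq_dotProduct, ← dotForm_eq_dotProduct, φ.map_app]; rfl
  have hxy := h (x + y)
  rw [map_add, Submodule.coe_add] at hxy
  simp only [add_dotProduct, dotProduct_add, h, dotProduct_comm (φ y) (φ x),
    dotProduct_comm (y : Fin n → F) x] at hxy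
  apply mul_left_cancel₀ h2
  linear_combination hxy

theorem IsOrthonormalFrame.isDotSubspace_span {k n : ℕ} {v : Fin k → Fin n → F}
    (hv : IsOrthonormalFrame v) : IsDotSubspace F n k (Submodule.span F (Set.range v)) := by
  refine ⟨by simpa using finrank_span_eq_card hv.linearIndependent, ?_⟩
  let b := Module.Basis.span hv.linearIndependent
  refine ⟨⟨b.equivFun, fun x => ?_⟩⟩
  obtain ⟨c, rfl⟩ := b.equivFun.symm.surjective x
  have hc : ((b.equivFun.symm c : Submodule.span F (Set.range v)) : Fin n → F) =
      ∑ i, c i • v i := by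
    simp [b, Module.Basis.equivFun_symm_apply, Module.Basis.span_apply]
  change dotForm F k (b.equivFun (b.equivFun.symm c)) =
    dotForm F n (b.equivFun.symm c : Submodule.span F (Set.range v))
  rw [LinearEquiv.apply_symm_apply, hc, dotForm_eq_dotProduct, dotForm_eq_dotProduct]
  simp only [sum_dotProduct, dotProduct_sum, smul_dotProduct, dotProduct_smul, hv _ _]
  simp [dotProduct]

theorem IsOrthonormalFrame.span_eq {k n : ℕ} {v : Fin k → Fin n → F} (hv : IsOrthonormalFrame v)
    {W : Submodule F (Fin n → F)} (hW : Module.finrank F W = k) (h : ∀ i, v i ∈ W) :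
    Submodule.span F (Set.range v) = W :=
  Submodule.eq_of_le_of_finrank_eq (Submodule.span_le.2 (Set.range_subset_iff.2 h))
    (hv.isDotSubspace_span.1.trans hW.symm)

/-- The frames spanning a `dot_k`-subspace correspond to the frames of `F ^ k`. -/
noncomputable def framesSpanningEquiv (h2 : (2 : F) ≠ 0) {n k : ℕ} {W : Submodule F (Fin n → F)}
    (hW : Module.finrank F W = k)
    (φ : (QuadraticMap.restrict (dotForm F n) W).IsometryEquiv (dotForm F k)) :
    {v : Fin k → Fin n → F // IsOrthonormalFrame v ∧ Submodule.span F (Set.range v) = W} ≃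
      {v : Fin k → Fin k → F // IsOrthonormalFrame v} where
  toFun v := ⟨fun i => φ ⟨v.1 i, v.2.2.le (Submodule.subset_span (Set.mem_range_self i))⟩,
    fun i j => by rw [dotProduct_eq_of_isometry h2]; exact v.2.1 i j⟩
  invFun w := ⟨fun i => (φ.toLinearEquiv.symm (w.1 i) : W), by
    have hf : IsOrthonormalFrame fun i => ((φ.toLinearEquiv.symm (w.1 i) : W) : Fin n → F) :=
      fun i j => by
        rw [← dotProduct_eq_of_isometry h2 φ, ← w.2 i j]
        congr 1 <;> exact φ.toLinearEquiv.apply_symm_apply _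
    exact ⟨hf, hf.span_eq hW fun i => Subtype.mem _⟩⟩
  left_inv v := by
    ext1
    funext i
    exact congrArg Subtype.val (φ.toLinearEquiv.symm_apply_apply _)
  right_inv w := by
    ext1
    funext i
    exact φ.toLinearEquiv.apply_symm_apply _

/-- Fibre the frames over their span. -/
theorem dotBinom_mul_frameCount (h2 : (2 : F) ≠ 0) (n k : ℕ) :
    dotBinom F n k * frameCount F k k = frameCount F n k := by
  rw [frameCount, dotBinom, ← Nat.card_prod]
  apply Nat.card_congr
  symm
  let f : {v : Fin k → Fin n → F // IsOrthonormalFrame v} →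
      {W : Submodule F (Fin n → F) // IsDotSubspace F n k W} :=
    fun v => ⟨Submodule.span F (Set.range v.1), v.2.isDotSubspace_span⟩
  refine (Equiv.sigmaFiberEquiv f).symm.trans
    ((Equiv.sigmaCongrRight fun W => ?_).trans (Equiv.sigmaEquivProd _ _))
  exact ((Equiv.subtypeEquivRight fun v => by simp [f, Subtype.ext_iff]).trans
    (Equiv.subtypeSubtypeEquivSubtypeInter _
      fun v => Submodule.span F (Set.range v) = W.1)).trans
    (framesSpanningEquiv h2 W.2.1 W.2.2.some)

theorem dotBinom_zero_right (h2 : (2 : F) ≠ 0) (n : ℕ) : dotBinom F n 0 = 1 := by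
  simpa [frameCount_zero_right] using dotBinom_mul_frameCount h2 n 0

theorem dotBinom_succ_succ [Finite F] (h2 : (2 : F) ≠ 0) (n k : ℕ) :
    dotBinom F (n + 1) (k + 1) * sphereCount F (k + 1) 1 =
      sphereCount F (n + 1) 1 * dotBinom F n k := by
  apply Nat.eq_of_mul_eq_mul_right (frameCount_self_pos (F := F) k)
  rw [mul_assoc, ← frameCount_succ_succ h2, dotBinom_mul_frameCount h2, frameCount_succ_succ h2,
    mul_assoc, dotBinom_mul_frameCount h2]

end Frames

/-! ### Counting unit vectors by character sums -/

section Spheres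

variable {F : Type*} [Field F] [Fintype F] [DecidableEq F]

theorem sum_ite_mul_self_eq (hF : ringChar F ≠ 2) (a : F) :
    ∑ x : F, (if x * x = a then 1 else 0 : ℤ) = 1 + quadraticChar F a := by
  rw [add_comm, ← quadraticChar_card_sqrts hF a, Finset.sum_boole]
  norm_cast
  congr 1
  ext x
  simp [pow_two]

/-- For a = 0 every nonzero b contributes χ(-1). For a ≠ 0 the substitution b = a c gives the Jacobi
sum J(χ, χ) = -χ(-1), as χ is its own inverse. -/
theorem sum_quadraticChar_mul_sub (hF : ringChar F ≠ 2) (a : F) :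
    ∑ b : F, quadraticChar F b * quadraticChar F (a - b) =
      (if a = 0 then (Fintype.card F : ℤ) * quadraticChar F (-1) else 0)
        - quadraticChar F (-1) := by
  split_ifs with ha
  · subst ha
    have h : ∀ b : F, quadraticChar F b * quadraticChar F (0 - b) =
        quadraticChar F (-1) * (1 - if b = 0 then 1 else 0) := fun b => by
      by_cases hb : b = 0
      · simp [hb]
      · rw [if_neg hb, zero_sub, ← neg_one_mul b, map_mul]
        linear_combination quadraticChar F (-1) * quadraticChar_sq_one hb
    simp only [h, ← Finset.mul_sum, Finset.sum_sub_distrib]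
    simp
    ring
  · have hJ : jacobiSum (quadraticChar F) (quadraticChar F) = -quadraticChar F (-1) := by
      have h := jacobiSum_nontrivial_inv (quadraticChar_ne_one hF)
      rwa [(quadraticChar_isQuadratic F).inv] at h
    rw [zero_sub, ← hJ, jacobiSum, ← Equiv.sum_comp (Equiv.mulLeft₀ a ha)]
    refine Finset.sum_congr rfl fun c _ => ?_
    rw [Equiv.mulLeft₀_apply, show a - a * c = a * (1 - c) by ring, map_mul, map_mul]
    linear_combination quadraticChar F c * quadraticChar F (1 - c) * quadraticChar_sq_one ha

theorem sum_ite_mul_self_add_mul_self_eq (hF : ringChar F ≠ 2) (a : F) :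
    ∑ x : F, ∑ y : F, (if x * x + y * y = a then 1 else 0 : ℤ) =
      Fintype.card F - quadraticChar F (-1) +
        Fintype.card F * quadraticChar F (-1) * (if a = 0 then 1 else 0) := by
  -- Insert b = x²; then y² = a - b has 1 + χ(a - b) solutions.
  have h1 : ∀ x : F, ∑ y : F, (if x * x + y * y = a then 1 else 0 : ℤ) =
      ∑ b : F, (if x * x = b then 1 else 0) * (1 + quadraticChar F (a - b)) := fun x => by
    simp only [← eq_sub_iff_add_eq', sum_ite_mul_self_eq hF]
    simp
  have h2 : ∑ b : F, quadraticChar F (a - b) = 0 := by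
    rw [← quadraticChar_sum_zero hF, ← (Equiv.subLeft a).sum_comp (quadraticChar F ·)]
    rfl
  simp only [h1]
  rw [Finset.sum_comm]
  simp only [← Finset.sum_mul, sum_ite_mul_self_eq hF, add_mul, mul_add, one_mul, mul_one,
    Finset.sum_add_distrib, h2, quadraticChar_sum_zero hF, sum_quadraticChar_mul_sub hF]
  split_ifs <;> simp <;> ring

theorem sum_fin_succ_pi {α : Type*} [Fintype α] {n : ℕ} (f : (Fin (n + 1) → α) → ℤ) :
    ∑ x, f x = ∑ a : α, ∑ y : Fin n → α, f (Fin.cons a y) := by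
  rw [← (Fin.consEquiv fun _ : Fin (n + 1) => α).sum_comp, Fintype.sum_prod_type]
  rfl

theorem sphereCount_eq_sum (n : ℕ) (a : F) :
    (sphereCount F n a : ℤ) = ∑ x : Fin n → F, if x ⬝ᵥ x = a then 1 else 0 := by
  rw [sphereCount, Nat.card_eq_fintype_card, Fintype.card_subtype, Finset.sum_boole]

/-- Split off two coordinates: their number of choices depends only on whether the remaining vector
y already has norm 1. -/
theorem sphereCount_add_two (hF : ringChar F ≠ 2) (n : ℕ) :
    (sphereCount F (n + 2) 1 : ℤ) =
      (Fintype.card F - quadraticChar F (-1)) * Fintype.card F ^ n +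
        Fintype.card F * quadraticChar F (-1) * sphereCount F n 1 := by
  have hd : ∀ (a b : F) (y : Fin n → F),
      ((Fin.cons a (Fin.cons b y) : Fin (n + 2) → F) ⬝ᵥ Fin.cons a (Fin.cons b y) = 1) =
        (a * a + b * b = 1 - y ⬝ᵥ y) := fun a b y => by
    simp only [dotProduct, Fin.sum_univ_succ, Fin.cons_zero, Fin.cons_succ, eq_sub_iff_add_eq,
      add_assoc]
  rw [sphereCount_eq_sum, sphereCount_eq_sum, sum_fin_succ_pi]
  simp only [sum_fin_succ_pi, hd]
  have hcomm : ∀ g : F → F → (Fin n → F) → ℤ,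
      ∑ a, ∑ b, ∑ y, g a b y = ∑ y, ∑ a, ∑ b, g a b y := fun g => by
    simp only [Finset.sum_comm (s := (Finset.univ : Finset F))
      (t := (Finset.univ : Finset (Fin n → F)))]
  rw [hcomm]
  simp only [sum_ite_mul_self_add_mul_self_eq hF, Finset.sum_add_distrib, ← Finset.mul_sum,
    sub_eq_zero (a := (1 : F)), eq_comm (a := (1 : F))]
  simp only [Finset.sum_const, Finset.card_univ, Fintype.card_pi, Finset.prod_const,
    Fintype.card_fin, nsmul_eq_mul, Nat.cast_pow]
  ring

/-- The factor q on the left avoids the exponent m - 1 and lets the induction start at m = 0. -/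
theorem sphereCount_even (hF : ringChar F ≠ 2) (m : ℕ) :
    (Fintype.card F : ℤ) * sphereCount F (2 * m) 1 =
      Fintype.card F ^ m * (Fintype.card F ^ m - quadraticChar F (-1) ^ m) := by
  induction m with
  | zero => simp [sphereCount_eq_sum]
  | succ m ih =>
    rw [mul_add_one, sphereCount_add_two hF]
    linear_combination (Fintype.card F : ℤ) * quadraticChar F (-1) * ih

theorem sphereCount_odd (hF : ringChar F ≠ 2) (m : ℕ) :
    (sphereCount F (2 * m + 1) 1 : ℤ) =
      Fintype.card F ^ m * (Fintype.card F ^ m + quadraticChar F (-1) ^ m) := by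
  induction m with
  | zero =>
    rw [mul_zero, zero_add, sphereCount_eq_sum, sum_fin_succ_pi]
    simp [dotProduct, sum_ite_mul_self_eq hF]
  | succ m ih =>
    rw [show 2 * (m + 1) + 1 = 2 * m + 1 + 2 by ring, sphereCount_add_two hF]
    linear_combination (Fintype.card F : ℤ) * quadraticChar F (-1) * ih

end Spheres

/-! ### Solving the recursion -/

theorem gaussBinom_zero_right (Q : ℚ) (n : ℕ) : gaussBinom Q n 0 = 1 := by simp [gaussBinom]

theorem gaussBinom_succ_succ {Q : ℚ} (hQ : 1 < Q) (n k : ℕ) :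
    gaussBinom Q (n + 1) (k + 1) * (Q ^ (k + 1) - 1) = (Q ^ (n + 1) - 1) * gaussBinom Q n k := by
  have h : Q ^ (k + 1) - 1 ≠ 0 := (sub_pos.2 (one_lt_pow₀ hQ k.succ_ne_zero)).ne'
  simp only [gaussBinom, Finset.prod_range_succ', Nat.add_sub_add_right, Nat.sub_zero]
  field_simp

/-- The closed forms of the dot-binomial coefficients for the four parities of `(n, k)`. -/
theorem dotBinom_closed_forms {F : Type*} [Field F] [Finite F] (h2 : (2 : F) ≠ 0) {q ε : ℚ} (hq : 1 < q) (hε : ε ^ 2 = 1)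
    (hodd : ∀ m, (sphereCount F (2 * m + 1) 1 : ℚ) = q ^ m * (q ^ m + ε ^ m))
    (heven : ∀ m, (sphereCount F (2 * (m + 1)) 1 : ℚ) =
      q ^ m * (q ^ (m + 1) - ε ^ (m + 1))) (b c : ℕ) :
    ((dotBinom F (2 * (b + c)) (2 * b) : ℚ) = 1 / 2 * q ^ (2 * b * c) *
        ((q ^ c + ε ^ c) * (q ^ b + ε ^ b) / (q ^ (b + c) + ε ^ (b + c))) *
        gaussBinom (q ^ 2) (b + c) b ∧
      (dotBinom F (2 * (b + c) + 1) (2 * b) : ℚ) = 1 / 2 * q ^ (2 * b * c + b) *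
        (q ^ b + ε ^ b) * gaussBinom (q ^ 2) (b + c) b) ∧
    (dotBinom F (2 * (b + c) + 1) (2 * b + 1) : ℚ) = 1 / 2 * q ^ (2 * b * c + c) *
        (q ^ c + ε ^ c) * gaussBinom (q ^ 2) (b + c) b ∧
      (dotBinom F (2 * (b + c) + 2) (2 * b + 1) : ℚ) = 1 / 2 * q ^ (2 * b * c + b + c) *
        (q ^ (b + c + 1) - ε ^ (b + c + 1)) * gaussBinom (q ^ 2) (b + c) b := by
  have hε' : ε = 1 ∨ ε = -1 := by simpa using hε
  have hq0 : ∀ m, q ^ m ≠ 0 := fun m => by positivity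
  have hqm : ∀ m, q ^ (m + 1) - ε ^ (m + 1) ≠ 0 := fun m => by
    have h1 : 1 < q ^ (m + 1) := one_lt_pow₀ hq m.succ_ne_zero
    have h2 : ε ^ (m + 1) ≤ 1 := (le_abs_self _).trans (by rcases hε' with rfl | rfl <;> simp)
    linarith
  have hqp : ∀ m, q ^ m + ε ^ m ≠ 0 := fun m => by
    rcases m with _ | m
    · norm_num
    · have h1 : 1 < q ^ (m + 1) := one_lt_pow₀ hq m.succ_ne_zero
      have h2 : -1 ≤ ε ^ (m + 1) := (abs_le.1 (by rcases hε' with rfl | rfl <;> simp)).1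
      linarith
  have hstep : ∀ n k, (dotBinom F (n + 1) (k + 1) : ℚ) * sphereCount F (k + 1) 1 =
      sphereCount F (n + 1) 1 * dotBinom F n k := fun n k => by
    exact_mod_cast dotBinom_succ_succ h2 n k
  have hfac : ∀ m, (q ^ 2) ^ m - 1 = (q ^ m - ε ^ m) * (q ^ m + ε ^ m) := fun m => by
    have : (ε ^ m) ^ 2 = 1 := by rw [← pow_mul, mul_comm, pow_mul, hε, one_pow]
    linear_combination this
  have hA : ∀ b c, (dotBinom F (2 * (b + c)) (2 * b) : ℚ) = 1 / 2 * q ^ (2 * b * c) *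
        ((q ^ c + ε ^ c) * (q ^ b + ε ^ b) / (q ^ (b + c) + ε ^ (b + c))) *
        gaussBinom (q ^ 2) (b + c) b →
      (dotBinom F (2 * (b + c) + 1) (2 * b + 1) : ℚ) = 1 / 2 * q ^ (2 * b * c + c) *
        (q ^ c + ε ^ c) * gaussBinom (q ^ 2) (b + c) b := fun b c ih => by
    have h := hstep (2 * (b + c)) (2 * b)
    rw [hodd, hodd, ih] at h
    apply mul_right_cancel₀ (mul_ne_zero (hq0 b) (hqp b))
    rw [h]
    field_simp [hqp (b + c)]
    ring
  have hC : ∀ b c, (dotBinom F (2 * (b + c) + 1) (2 * b) : ℚ) = 1 / 2 * q ^ (2 * b * c + b) *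
        (q ^ b + ε ^ b) * gaussBinom (q ^ 2) (b + c) b →
      (dotBinom F (2 * (b + c) + 2) (2 * b + 1) : ℚ) = 1 / 2 * q ^ (2 * b * c + b + c) *
        (q ^ (b + c + 1) - ε ^ (b + c + 1)) * gaussBinom (q ^ 2) (b + c) b := fun b c ih => by
    have h := hstep (2 * (b + c) + 1) (2 * b)
    rw [hodd, show 2 * (b + c) + 1 + 1 = 2 * (b + c + 1) by ring, heven, ih] at h
    apply mul_right_cancel₀ (mul_ne_zero (hq0 b) (hqp b))
    rw [show 2 * (b + c) + 2 = 2 * (b + c + 1) by ring, h]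
    ring
  have hgauss : ∀ b c, gaussBinom (q ^ 2) (b + c + 1) (b + 1) *
      ((q ^ (b + 1) - ε ^ (b + 1)) * (q ^ (b + 1) + ε ^ (b + 1))) =
      (q ^ (b + c + 1) - ε ^ (b + c + 1)) * (q ^ (b + c + 1) + ε ^ (b + c + 1)) *
        gaussBinom (q ^ 2) (b + c) b := fun b c => by
    rw [← hfac, ← hfac]
    exact gaussBinom_succ_succ (one_lt_pow₀ hq two_ne_zero) _ _
  -- The recursion preserves n - k, here 2c or 2c + 1. `hA` and `hC` pass from k = 2b to 2b + 1, so
  -- the induction on b, with c fixed, needs only even k.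
  suffices hDB : (dotBinom F (2 * (b + c)) (2 * b) : ℚ) = 1 / 2 * q ^ (2 * b * c) *
        ((q ^ c + ε ^ c) * (q ^ b + ε ^ b) / (q ^ (b + c) + ε ^ (b + c))) *
        gaussBinom (q ^ 2) (b + c) b ∧
      (dotBinom F (2 * (b + c) + 1) (2 * b) : ℚ) = 1 / 2 * q ^ (2 * b * c + b) *
        (q ^ b + ε ^ b) * gaussBinom (q ^ 2) (b + c) b from
    ⟨hDB, hA b c hDB.1, hC b c hDB.2⟩
  induction b with
  | zero =>
    -- At k = 0 the factor q^0 + ε^0 = 2 cancels the 1/2.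
    have := hqp c
    simp only [mul_zero, zero_mul, dotBinom_zero_right h2, gaussBinom_zero_right, zero_add]
    constructor
    · field_simp
      norm_num
    · norm_num
  | succ b ih =>
    rw [show b + 1 + c = b + c + 1 by ring]
    constructor
    · have h := hstep (2 * (b + c) + 1) (2 * b + 1)
      rw [show 2 * (b + c) + 1 + 1 = 2 * (b + c + 1) by ring,
        show 2 * b + 1 + 1 = 2 * (b + 1) by ring, heven, heven, hA b c ih.1] at h
      apply mul_right_cancel₀ (mul_ne_zero (hq0 b) (hqm b))
      rw [h]
      have := hqp (b + c + 1)
      field_simp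
      linear_combination (-q ^ (2 * b * c + b + 2 * c) * (q ^ c + ε ^ c)) * hgauss b c
    · have h := hstep (2 * (b + c) + 2) (2 * b + 1)
      rw [show 2 * (b + c) + 2 + 1 = 2 * (b + c + 1) + 1 by ring,
        show 2 * b + 1 + 1 = 2 * (b + 1) by ring, hodd, heven, hC b c ih.2] at h
      apply mul_right_cancel₀ (mul_ne_zero (hq0 b) (hqm b))
      rw [h]
      linear_combination (-1 / 2 * q ^ (2 * b * c + 2 * b + 2 * c + 1)) * hgauss b c

/-- The closed forms of the dot-binomial coefficients, with all signs powers of the quadratic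
character of `-1`. -/
theorem dotBinom_eq {F : Type*} [Field F] [Fintype F] [DecidableEq F] (hF : ringChar F ≠ 2)
    {q ε : ℚ} (hq : q = Fintype.card F) (hε : ε = (quadraticChar F (-1) : ℤ))
    {n k : ℕ} (hkn : k ≤ n) :
    (Odd n → Odd k → (dotBinom F n k : ℚ) =
      1 / 2 * q ^ (k * (n - k) / 2) * (q ^ ((n - k) / 2) + ε ^ ((n - k) / 2)) *
        gaussBinom (q ^ 2) ((n - 1) / 2) ((k - 1) / 2)) ∧
    (Odd n → Even k → (dotBinom F n k : ℚ) =
      1 / 2 * q ^ (k * (n - k) / 2) * (q ^ (k / 2) + ε ^ (k / 2)) *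
        gaussBinom (q ^ 2) ((n - 1) / 2) (k / 2)) ∧
    (Even n → Odd k → (dotBinom F n k : ℚ) =
      1 / 2 * q ^ ((k * (n - k) - 1) / 2) * (q ^ (n / 2) - ε ^ (n / 2)) *
        gaussBinom (q ^ 2) ((n - 2) / 2) ((k - 1) / 2)) ∧
    (Even n → Even k → (dotBinom F n k : ℚ) =
      1 / 2 * q ^ (k * (n - k) / 2) * ((q ^ ((n - k) / 2) + ε ^ ((n - k) / 2)) *
        (q ^ (k / 2) + ε ^ (k / 2)) / (q ^ (n / 2) + ε ^ (n / 2))) *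
        gaussBinom (q ^ 2) (n / 2) (k / 2)) := by
  have hq1 : 1 < q := by rw [hq]; exact_mod_cast Fintype.one_lt_card
  have hε2 : ε ^ 2 = 1 := by
    rw [hε]; exact_mod_cast quadraticChar_sq_one (neg_ne_zero.2 (one_ne_zero (α := F)))
  have hodd : ∀ m, (sphereCount F (2 * m + 1) 1 : ℚ) = q ^ m * (q ^ m + ε ^ m) := fun m => by
    rw [hq, hε]; exact_mod_cast sphereCount_odd hF m
  have heven : ∀ m, (sphereCount F (2 * (m + 1)) 1 : ℚ) =
      q ^ m * (q ^ (m + 1) - ε ^ (m + 1)) := fun m => by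
    apply mul_left_cancel₀ (show q ≠ 0 by positivity)
    rw [← mul_assoc, ← pow_succ', hq, hε]
    exact_mod_cast sphereCount_even hF (m + 1)
  have key := dotBinom_closed_forms (Ring.two_ne_zero hF) hq1 hε2 hodd heven
  have hdiv : ∀ x y : ℕ, x = 2 * y → x / 2 = y := fun x y h => by omega
  refine ⟨?_, ?_, ?_, ?_⟩
  · rintro ⟨a, rfl⟩ ⟨b, rfl⟩
    obtain ⟨c, rfl⟩ := Nat.exists_eq_add_of_le (show b ≤ a by omega)
    have h := (key b c).2.1
    rw [show 2 * (b + c) + 1 - (2 * b + 1) = 2 * c by omega,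
      hdiv ((2 * b + 1) * (2 * c)) (2 * b * c + c) (by ring)]
    simpa using h
  · rintro ⟨a, rfl⟩ hk
    obtain ⟨b, rfl⟩ := hk.two_dvd
    obtain ⟨c, rfl⟩ := Nat.exists_eq_add_of_le (show b ≤ a by omega)
    have h := (key b c).1.2
    rw [show 2 * (b + c) + 1 - 2 * b = 2 * c + 1 by omega,
      hdiv (2 * b * (2 * c + 1)) (2 * b * c + b) (by ring)]
    simpa using h
  · rintro hn ⟨b, rfl⟩
    obtain ⟨a, rfl⟩ := hn.two_dvd
    obtain ⟨c, rfl⟩ := Nat.exists_eq_add_of_le (show b + 1 ≤ a by omega)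
    have h := (key b c).2.2
    rw [show 2 * (b + 1 + c) - (2 * b + 1) = 2 * c + 1 by omega,
      show (2 * b + 1) * (2 * c + 1) = 2 * (2 * b * c + b + c) + 1 by ring,
      show 2 * (b + 1 + c) = 2 * (b + c) + 2 by ring]
    simpa using h
  · intro hn hk
    obtain ⟨a, rfl⟩ := hn.two_dvd
    obtain ⟨b, rfl⟩ := hk.two_dvd
    obtain ⟨c, rfl⟩ := Nat.exists_eq_add_of_le (show b ≤ a by omega)
    have h := (key b c).1.1
    rw [show 2 * (b + c) - 2 * b = 2 * c by omega,
      hdiv (2 * b * (2 * c)) (2 * b * c) (by ring)]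
    simpa using h

/-! ### Reading off the signs from residues mod 4 -/

theorem mainTheorem5 (F : Type*) [Field F] [Fintype F] (q : ℕ) (hq : Fintype.card F = q)
    (n k : ℕ) (hkn : k ≤ n) :
    (q % 4 = 1 →
      (Odd n → Odd k →
        (dotBinom F n k : ℚ) =
          (1 / 2 : ℚ) * (q : ℚ) ^ (k * (n - k) / 2) * ((q : ℚ) ^ ((n - k) / 2) + 1) *
            gaussBinom ((q : ℚ) ^ 2) ((n - 1) / 2) ((k - 1) / 2)) ∧
      (Odd n → Even k →
        (dotBinom F n k : ℚ) =
          (1 / 2 : ℚ) * (q : ℚ) ^ (k * (n - k) / 2) * ((q : ℚ) ^ (k / 2) + 1) *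
            gaussBinom ((q : ℚ) ^ 2) ((n - 1) / 2) (k / 2)) ∧
      (Even n → Odd k →
        (dotBinom F n k : ℚ) =
          (1 / 2 : ℚ) * (q : ℚ) ^ ((k * (n - k) - 1) / 2) * ((q : ℚ) ^ (n / 2) - 1) *
            gaussBinom ((q : ℚ) ^ 2) ((n - 2) / 2) ((k - 1) / 2)) ∧
      (Even n → Even k →
        (dotBinom F n k : ℚ) =
          (1 / 2 : ℚ) * (q : ℚ) ^ (k * (n - k) / 2) *
            (((q : ℚ) ^ ((n - k) / 2) + 1) * ((q : ℚ) ^ (k / 2) + 1) / ((q : ℚ) ^ (n / 2) + 1)) *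
            gaussBinom ((q : ℚ) ^ 2) (n / 2) (k / 2))) ∧
    (q % 4 = 3 →
      (n % 4 = 1 → k % 4 = 1 →
        (dotBinom F n k : ℚ) =
          (1 / 2 : ℚ) * (q : ℚ) ^ (k * (n - k) / 2) * ((q : ℚ) ^ ((n - k) / 2) + 1) *
            gaussBinom ((q : ℚ) ^ 2) ((n - 1) / 2) ((k - 1) / 2)) ∧
      (n % 4 = 1 → k % 4 = 2 →
        (dotBinom F n k : ℚ) =
          (1 / 2 : ℚ) * (q : ℚ) ^ (k * (n - k) / 2) * ((q : ℚ) ^ (k / 2) - 1) *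
            gaussBinom ((q : ℚ) ^ 2) ((n - 1) / 2) (k / 2)) ∧
      (n % 4 = 2 → k % 4 = 1 →
        (dotBinom F n k : ℚ) =
          (1 / 2 : ℚ) * (q : ℚ) ^ ((k * (n - k) - 1) / 2) * ((q : ℚ) ^ (n / 2) + 1) *
            gaussBinom ((q : ℚ) ^ 2) ((n - 2) / 2) ((k - 1) / 2)) ∧
      (n % 4 = 2 → k % 4 = 2 →
        (dotBinom F n k : ℚ) =
          (1 / 2 : ℚ) * (q : ℚ) ^ (k * (n - k) / 2) *
            (((q : ℚ) ^ ((n - k) / 2) + 1) * ((q : ℚ) ^ (k / 2) - 1) / ((q : ℚ) ^ (n / 2) - 1)) *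
            gaussBinom ((q : ℚ) ^ 2) (n / 2) (k / 2)) ∧
      (n % 4 = 3 → k % 4 = 1 →
        (dotBinom F n k : ℚ) =
          (1 / 2 : ℚ) * (q : ℚ) ^ (k * (n - k) / 2) * ((q : ℚ) ^ ((n - k) / 2) - 1) *
            gaussBinom ((q : ℚ) ^ 2) ((n - 1) / 2) ((k - 1) / 2)) ∧
      (n % 4 = 3 → k % 4 = 2 →
        (dotBinom F n k : ℚ) =
          (1 / 2 : ℚ) * (q : ℚ) ^ (k * (n - k) / 2) * ((q : ℚ) ^ (k / 2) - 1) *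
            gaussBinom ((q : ℚ) ^ 2) ((n - 1) / 2) (k / 2)) ∧
      (n % 4 = 0 → k % 4 = 1 →
        (dotBinom F n k : ℚ) =
          (1 / 2 : ℚ) * (q : ℚ) ^ ((k * (n - k) - 1) / 2) * ((q : ℚ) ^ (n / 2) - 1) *
            gaussBinom ((q : ℚ) ^ 2) ((n - 2) / 2) ((k - 1) / 2)) ∧
      (n % 4 = 0 → k % 4 = 2 →
        (dotBinom F n k : ℚ) =
          (1 / 2 : ℚ) * (q : ℚ) ^ (k * (n - k) / 2) *
            (((q : ℚ) ^ ((n - k) / 2) - 1) * ((q : ℚ) ^ (k / 2) - 1) / ((q : ℚ) ^ (n / 2) + 1)) *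
            gaussBinom ((q : ℚ) ^ 2) (n / 2) (k / 2)) ∧
      (n % 4 = 1 → k % 4 = 3 →
        (dotBinom F n k : ℚ) =
          (1 / 2 : ℚ) * (q : ℚ) ^ (k * (n - k) / 2) * ((q : ℚ) ^ ((n - k) / 2) - 1) *
            gaussBinom ((q : ℚ) ^ 2) ((n - 1) / 2) ((k - 1) / 2)) ∧
      (n % 4 = 1 → k % 4 = 0 →
        (dotBinom F n k : ℚ) =
          (1 / 2 : ℚ) * (q : ℚ) ^ (k * (n - k) / 2) * ((q : ℚ) ^ (k / 2) + 1) *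
            gaussBinom ((q : ℚ) ^ 2) ((n - 1) / 2) (k / 2)) ∧
      (n % 4 = 2 → k % 4 = 3 →
        (dotBinom F n k : ℚ) =
          (1 / 2 : ℚ) * (q : ℚ) ^ ((k * (n - k) - 1) / 2) * ((q : ℚ) ^ (n / 2) + 1) *
            gaussBinom ((q : ℚ) ^ 2) ((n - 2) / 2) ((k - 1) / 2)) ∧
      (n % 4 = 2 → k % 4 = 0 →
        (dotBinom F n k : ℚ) =
          (1 / 2 : ℚ) * (q : ℚ) ^ (k * (n - k) / 2) *
            (((q : ℚ) ^ ((n - k) / 2) - 1) * ((q : ℚ) ^ (k / 2) + 1) / ((q : ℚ) ^ (n / 2) - 1)) *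
            gaussBinom ((q : ℚ) ^ 2) (n / 2) (k / 2)) ∧
      (n % 4 = 3 → k % 4 = 3 →
        (dotBinom F n k : ℚ) =
          (1 / 2 : ℚ) * (q : ℚ) ^ (k * (n - k) / 2) * ((q : ℚ) ^ ((n - k) / 2) + 1) *
            gaussBinom ((q : ℚ) ^ 2) ((n - 1) / 2) ((k - 1) / 2)) ∧
      (n % 4 = 3 → k % 4 = 0 →
        (dotBinom F n k : ℚ) =
          (1 / 2 : ℚ) * (q : ℚ) ^ (k * (n - k) / 2) * ((q : ℚ) ^ (k / 2) + 1) *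
            gaussBinom ((q : ℚ) ^ 2) ((n - 1) / 2) (k / 2)) ∧
      (n % 4 = 0 → k % 4 = 3 →
        (dotBinom F n k : ℚ) =
          (1 / 2 : ℚ) * (q : ℚ) ^ ((k * (n - k) - 1) / 2) * ((q : ℚ) ^ (n / 2) - 1) *
            gaussBinom ((q : ℚ) ^ 2) ((n - 2) / 2) ((k - 1) / 2)) ∧
      (n % 4 = 0 → k % 4 = 0 →
        (dotBinom F n k : ℚ) =
          (1 / 2 : ℚ) * (q : ℚ) ^ (k * (n - k) / 2) *
            (((q : ℚ) ^ ((n - k) / 2) + 1) * ((q : ℚ) ^ (k / 2) + 1) / ((q : ℚ) ^ (n / 2) + 1)) *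
            gaussBinom ((q : ℚ) ^ 2) (n / 2) (k / 2))) := by
  classical
  have hε := fun hF : ringChar F ≠ 2 => quadraticChar_neg_one hF
  have hF : q % 2 = 1 → ringChar F ≠ 2 := fun h h2 => by
    have := FiniteField.even_card_of_char_two h2
    omega
  rw [hq] at hε
  refine ⟨fun h => ?_, fun h => ?_⟩
  · have h1 : (1 : ℚ) = (quadraticChar F (-1) : ℤ) := by
      rw [hε (hF (by omega)), ZMod.χ₄_nat_one_mod_four h, Int.cast_one]
    have key := dotBinom_eq (hF (by omega)) (congrArg _ hq.symm : (q : ℚ) = _) h1 hkn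
    simpa only [one_pow] using key
  · have h1 : (-1 : ℚ) = (quadraticChar F (-1) : ℤ) := by
      rw [hε (hF (by omega)), ZMod.χ₄_nat_three_mod_four h, Int.cast_neg, Int.cast_one]
    obtain ⟨hA, hB, hC, hD⟩ :=
      dotBinom_eq (hF (by omega)) (congrArg _ hq.symm : (q : ℚ) = _) h1 hkn
    simp only [Nat.odd_iff, Nat.even_iff] at hA hB hC hD
    -- Here ε = -1, and n, k mod 4 fix the parities of the exponents (n - k)/2, k/2 and n/2 that
    -- occur.
    have hs : ∀ m : ℕ, (-1 : ℚ) ^ m = if m % 2 = 0 then 1 else -1 := fun m => by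
      split_ifs with hm
      · exact (Nat.even_iff.2 hm).neg_one_pow
      · exact (Nat.odd_iff.2 (by omega)).neg_one_pow
    simp only [hs] at hA hB hC hD
    refine ⟨?_, ?_, ?_, ?_, ?_, ?_, ?_, ?_, ?_, ?_, ?_, ?_, ?_, ?_, ?_, ?_⟩ <;> intro hn hk
    · simpa only [if_pos (by omega : ((n - k) / 2) % 2 = 0), sub_neg_eq_add, ← sub_eq_add_neg] using hA (by omega) (by omega)
    · simpa only [if_neg (by omega : ¬(k / 2) % 2 = 0), sub_neg_eq_add, ← sub_eq_add_neg] using hB (by omega) (by omega)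
    · simpa only [if_neg (by omega : ¬(n / 2) % 2 = 0), sub_neg_eq_add, ← sub_eq_add_neg] using hC (by omega) (by omega)
    · simpa only [if_pos (by omega : ((n - k) / 2) % 2 = 0), if_neg (by omega : ¬(k / 2) % 2 = 0), if_neg (by omega : ¬(n / 2) % 2 = 0), sub_neg_eq_add, ← sub_eq_add_neg] using hD (by omega) (by omega)
    · simpa only [if_neg (by omega : ¬((n - k) / 2) % 2 = 0), sub_neg_eq_add, ← sub_eq_add_neg] using hA (by omega) (by omega)
    · simpa only [if_neg (by omega : ¬(k / 2) % 2 = 0), sub_neg_eq_add, ← sub_eq_add_neg] using hB (by omega) (by omega)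
    · simpa only [if_pos (by omega : (n / 2) % 2 = 0), sub_neg_eq_add, ← sub_eq_add_neg] using hC (by omega) (by omega)
    · simpa only [if_neg (by omega : ¬((n - k) / 2) % 2 = 0), if_neg (by omega : ¬(k / 2) % 2 = 0), if_pos (by omega : (n / 2) % 2 = 0), sub_neg_eq_add, ← sub_eq_add_neg] using hD (by omega) (by omega)
    · simpa only [if_neg (by omega : ¬((n - k) / 2) % 2 = 0), sub_neg_eq_add, ← sub_eq_add_neg] using hA (by omega) (by omega)
    · simpa only [if_pos (by omega : (k / 2) % 2 = 0), sub_neg_eq_add, ← sub_eq_add_neg] using hB (by omega) (by omega)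
    · simpa only [if_neg (by omega : ¬(n / 2) % 2 = 0), sub_neg_eq_add, ← sub_eq_add_neg] using hC (by omega) (by omega)
    · simpa only [if_neg (by omega : ¬((n - k) / 2) % 2 = 0), if_pos (by omega : (k / 2) % 2 = 0), if_neg (by omega : ¬(n / 2) % 2 = 0), sub_neg_eq_add, ← sub_eq_add_neg] using hD (by omega) (by omega)
    · simpa only [if_pos (by omega : ((n - k) / 2) % 2 = 0), sub_neg_eq_add, ← sub_eq_add_neg] using hA (by omega) (by omega)
    · simpa only [if_pos (by omega : (k / 2) % 2 = 0), sub_neg_eq_add, ← sub_eq_add_neg] using hB (by omega) (by omega)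
    · simpa only [if_pos (by omega : (n / 2) % 2 = 0), sub_neg_eq_add, ← sub_eq_add_neg] using hC (by omega) (by omega)
    · simpa only [if_pos (by omega : ((n - k) / 2) % 2 = 0), if_pos (by omega : (k / 2) % 2 = 0), if_pos (by omega : (n / 2) % 2 = 0), sub_neg_eq_add, ← sub_eq_add_neg] using hD (by omega) (by omega)
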